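/- Let $\mathsf{Solv}$ be $\mathbb R^3$ with the group law $(x,y,z)\cdot(x',y',z')=(x+e^{-z}x',\,y+e^{z}y',\,z+z')$ and the left-invariant metric $e^{2z}dx^2+e^{-2z}dy^2+dz^2$, and let $\Gamma\subset\mathsf{Solv}$ be a lattice (a discrete cocompact subgroup), so that $\tilde Y=\Gamma\backslash\mathsf{Solv}$ is a compact $\mathsf{Solv}$ torus bundle with $b_1=1$. Let $\mathfrak s_*$ be the spin structure on $\tilde Y$ given by the left-invariant orthonormal frame $e_1=\partial_z$, $e_2=e^{-z}\partial_x$, $e_3=e^{z}\partial_y$: its spinor bundle is $\tilde Y\times\mathbb C^2$, on which $e_1,e_2,e_3$ act by $$\sigma_1=\begin{bmatrix} i&0\\0&-i\end{bmatrix},\quad \sigma_2=\begin{bmatrix}0&-1\\1&0\end{bmatrix},\quad \sigma_3=\begin{bmatrix}0&i\\i&0\end{bmatrix}.$$ Let $B_*$ be the spin connection induced by the Levi-Civita connection, $\nabla_{e_i}\Psi=e_i(\Psi)+\frac14\sum_{j<k}\Gamma_{ijk}[\sigma_j,\sigma_k]\Psi$ with $\Gamma_{ijk}=\langle\nabla_{e_i}e_j,e_k\rangle$,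 and let $D_{B_*}\Psi=\sum_i\sigma_i\nabla_{e_i}\Psi$ be the Dirac operator on smooth spinors. (1) The kernel of $D_{B_*}$ consists exactly of the constant spinors $\tilde Y\to\mathbb C^2$. (2) Let $v,w$ be a basis of the lattice $\Lambda=\Gamma\cap\mathbb R^2$ (where $\mathbb R^2=\{z=0\}$) such that the map $\sigma(av+bw,z)=((a+\tfrac12)v-bw,\,-z)$ of $\mathsf{Solv}$ is an isometry which descends to a fixed-point-free involution of $\tilde Y$, and let $Y$ be the quotient of $\tilde Y$ by this involution (a $\mathsf{Solv}$ rational homology sphere). Then for every spin structure $\mathfrak s_0$ on $Y$, the Dirac operator of $(Y,\mathfrak s_0)$ for the Levi-Civita spin connection has no kernel: its only smooth harmonic spinor is $0$. -/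

import Mathlib

open scoped ContDiff

/-- The space underlying Solv geometry, `ℝ³` with coordinates `(x, y, z)`.  As an additive group and
normed space it is the coordinate space (used for differentiation, and for the coordinates of
tangent vectors); as a multiplicative group it is the solvable Lie group Solv. -/
def Solv : Type := ℝ × ℝ × ℝ

namespace Solv

noncomputable instance : NormedAddCommGroup Solv := inferInstanceAs (NormedAddCommGroup (ℝ × ℝ × ℝ))

noncomputable instance : NormedSpace ℝ Solv := inferInstanceAs (NormedSpace ℝ (ℝ × ℝ × ℝ))

/-- The point (or tangent vector) with the given coordinates. -/
def mk (x y z : ℝ) : Solv := (x, y, z)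

/-- The coordinate `x`. -/
def x (p : Solv) : ℝ := p.1

/-- The coordinate `y`. -/
def y (p : Solv) : ℝ := p.2.1

/-- The coordinate `z`. -/
def z (p : Solv) : ℝ := p.2.2

@[simp] theorem x_mk (a b c : ℝ) : (mk a b c).x = a := rfl
@[simp] theorem y_mk (a b c : ℝ) : (mk a b c).y = b := rfl
@[simp] theorem z_mk (a b c : ℝ) : (mk a b c).z = c := rfl

@[ext] theorem ext {p q : Solv} (hx : p.x = q.x) (hy : p.y = q.y) (hz : p.z = q.z) : p = q :=
  Prod.ext hx (Prod.ext hy hz)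

/-- `(x, y, z) · (x', y', z') = (x + e^{-z} x', y + e^z y', z + z')`. -/
noncomputable instance : Mul Solv :=
  ⟨fun p q => mk (p.x + Real.exp (-p.z) * q.x) (p.y + Real.exp p.z * q.y) (p.z + q.z)⟩

noncomputable instance : One Solv := ⟨mk 0 0 0⟩

noncomputable instance : Inv Solv :=
  ⟨fun p => mk (-(Real.exp p.z * p.x)) (-(Real.exp (-p.z) * p.y)) (-p.z)⟩

theorem mul_def (p q : Solv) :
    p * q = mk (p.x + Real.exp (-p.z) * q.x) (p.y + Real.exp p.z * q.y) (p.z + q.z) := rfl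

theorem one_def : (1 : Solv) = mk 0 0 0 := rfl

theorem inv_def (p : Solv) :
    p⁻¹ = mk (-(Real.exp p.z * p.x)) (-(Real.exp (-p.z) * p.y)) (-p.z) := rfl

noncomputable instance : Group Solv :=
  Group.ofLeftAxioms
    (by
      intro a b c
      ext <;> simp [mul_def, Real.exp_add] <;> ring)
    (by
      intro a
      ext <;> simp [mul_def, one_def])
    (by
      intro a
      ext <;> simp [mul_def, one_def, inv_def])

/-! ### Riemannian geometry -/

/-- The Solv metric `e^{2z} dx² + e^{-2z} dy² + dz²` at the point `p`. -/
noncomputable def metric (p u w : Solv) : ℝ :=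
  Real.exp (2 * p.z) * (u.x * w.x) + Real.exp (-(2 * p.z)) * (u.y * w.y) + u.z * w.z

/-- The left-invariant orthonormal frame `e₁ = ∂_z`, `e₂ = e^{-z} ∂_x`, `e₃ = e^z ∂_y`. -/
noncomputable def frame (i : Fin 3) (p : Solv) : Solv :=
  ![mk 0 0 1, mk (Real.exp (-p.z)) 0 0, mk 0 (Real.exp p.z) 0] i

/-- `⟨∇_X Y, Z⟩` for the Levi-Civita connection `∇` of the Solv metric, by Koszul's formula. -/
noncomputable def leviCivita (X Y Z : Solv → Solv) (p : Solv) : ℝ :=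
  (1 / 2) *
    (fderiv ℝ (fun q => metric q (Y q) (Z q)) p (X p)
      + fderiv ℝ (fun q => metric q (Z q) (X q)) p (Y p)
      - fderiv ℝ (fun q => metric q (X q) (Y q)) p (Z p)
      + metric p (VectorField.lieBracket ℝ X Y p) (Z p)
      - metric p (VectorField.lieBracket ℝ Y Z p) (X p)
      + metric p (VectorField.lieBracket ℝ Z X p) (Y p))

/-- The Christoffel symbols `Γ_{ijk} = ⟨∇_{e_i} e_j, e_k⟩` in the left-invariant frame. -/
noncomputable def christoffel (i j k : Fin 3) (p : Solv) : ℝ :=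
  leviCivita (frame i) (frame j) (frame k) p

/-! ### Spin geometry of the universal cover -/

/-- The Pauli matrices, through which `e₁`, `e₂`, `e₃` act on spinors. -/
noncomputable def pauli (i : Fin 3) : Matrix (Fin 2) (Fin 2) ℂ :=
  ![!![Complex.I, 0; 0, -Complex.I], !![0, -1; 1, 0], !![0, Complex.I; Complex.I, 0]] i

/-- Clifford multiplication by the tangent vector `u` at the point `p`. -/
noncomputable def clifford (p u : Solv) : Matrix (Fin 2) (Fin 2) ℂ :=
  ∑ k, (metric p u (frame k p) : ℂ) • pauli k

/-- The covariant derivative `∇_{e_i} ψ = e_i(ψ) + ¼ ∑_{j<k} Γ_{ijk} [σ_j, σ_k] ψ` of a spinor for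
the spin connection induced by the Levi-Civita connection. -/
noncomputable def spinConnection (i : Fin 3) (ψ : Solv → Fin 2 → ℂ) (p : Solv) : Fin 2 → ℂ :=
  fderiv ℝ ψ p (frame i p) +
    ((1 / 4 : ℂ) • ∑ j, ∑ k ∈ Finset.Ioi j,
      (christoffel i j k p : ℂ) • (pauli j * pauli k - pauli k * pauli j)).mulVec (ψ p)

/-- The Dirac operator `D ψ = ∑ᵢ ρ(e_i) ∇_{e_i} ψ`. -/
noncomputable def dirac (ψ : Solv → Fin 2 → ℂ) (p : Solv) : Fin 2 → ℂ :=
  ∑ i, (clifford p (frame i p)).mulVec (spinConnection i ψ p)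

/-! ### Quotients, their spin structures and spinors -/

/-- A lattice in Solv: a discrete subgroup `Γ` for which `Γ \ Solv` is compact. -/
structure IsLattice (Γ : Subgroup Solv) : Prop where
  discrete : DiscreteTopology Γ
  cocompact : CompactSpace (Quotient (MulAction.orbitRel Γ Solv))

/-- The group of left translations of Solv by elements of `Γ`, that is the deck group of
`Solv → Γ \ Solv`. -/
noncomputable def translations (Γ : Subgroup Solv) : Subgroup (Equiv.Perm Solv) :=
  Γ.map (MulAction.toPermHom Solv Solv)

/-- A spin structure on the quotient `G \ Solv` by a group `G` of oriented isometries acting freely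
and properly discontinuously.  As Solv is simply connected and its spin bundle is trivialized by the
left-invariant frame, it is a lift of the action of `G` on oriented orthonormal frames to the spin
bundle, that is a homomorphism from `G` to `Spin(3) = SU(2)` which lies over the action of the
differentials of the elements of `G` on the left-invariant frame. -/
structure SpinStructure (G : Subgroup (Equiv.Perm Solv)) where
  lift : G →* Matrix.specialUnitaryGroup (Fin 2) ℂ
  lift_clifford : ∀ (φ : G) (p u : Solv),
    clifford (φ.1 p) (fderiv ℝ φ.1 p u) * (lift φ).1 = (lift φ).1 * clifford p u

/-- Smooth spinors on `G \ Solv`: smooth sections of the quotient of the trivial bundle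
`Solv × ℂ²` by the lifted action, written as equivariant smooth functions on Solv. -/
def spinors {G : Subgroup (Equiv.Perm Solv)} (s : SpinStructure G) : Set (Solv → Fin 2 → ℂ) :=
  {ψ | ContDiff ℝ ∞ ψ ∧ ∀ (φ : G) (p : Solv), ψ (φ.1 p) = (s.lift φ).1.mulVec (ψ p)}

/-- The kernel of the Dirac operator on `G \ Solv` with the spin structure `s`. -/
noncomputable def kerDirac {G : Subgroup (Equiv.Perm Solv)} (s : SpinStructure G) :
    Set (Solv → Fin 2 → ℂ) :=
  {ψ | ψ ∈ spinors s ∧ ∀ p, dirac ψ p = 0}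

theorem fderiv_mul_left (g p u : Solv) :
    fderiv ℝ (fun q : Solv => g * q) p u
      = mk (Real.exp (-g.z) * u.x) (Real.exp g.z * u.y) u.z := by
  have h : HasFDerivAt (fun q : ℝ × ℝ × ℝ =>
      ((g.x + Real.exp (-g.z) * q.1, g.y + Real.exp g.z * q.2.1, g.z + q.2.2) : ℝ × ℝ × ℝ))
      _ p :=
    (((hasFDerivAt_fst (𝕜 := ℝ) (p := (p : ℝ × ℝ × ℝ))).const_mul (Real.exp (-g.z))).const_add
      g.x).prodMk
      (((((hasFDerivAt_snd (𝕜 := ℝ) (p := (p : ℝ × ℝ × ℝ))).fst).const_mul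
        (Real.exp g.z)).const_add g.y).prodMk
        (((hasFDerivAt_snd (𝕜 := ℝ) (p := (p : ℝ × ℝ × ℝ))).snd).const_add g.z))
  exact (DFunLike.congr_fun (HasFDerivAt.fderiv h) u).trans rfl

theorem clifford_mul_left (g p u : Solv) :
    clifford (g * p) (fderiv ℝ (fun q : Solv => g * q) p u) = clifford p u := by
  rw [fderiv_mul_left]
  unfold clifford
  refine Finset.sum_congr rfl fun k _ => ?_
  congr 2
  fin_cases k
  · simp [metric, frame, mul_def]
  · simp only [metric, frame, mul_def]
    simp
    rw [show 2 * (g.z + p.z) = g.z + g.z + (p.z + p.z) by ring,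
      show 2 * p.z = p.z + p.z by ring]
    simp only [Real.exp_add, Real.exp_neg]
    field_simp
  · simp only [metric, frame, mul_def]
    simp
    rw [show -(2 * (g.z + p.z)) = -g.z + -g.z + (-p.z + -p.z) by ring,
      show -(2 * p.z) = -p.z + -p.z by ring]
    simp only [Real.exp_add, Real.exp_neg]
    field_simp

/-- The spin structure on `Γ \ Solv` given by the left-invariant frame: the frame descends to the
quotient, the spinor bundle is the trivial bundle `(Γ \ Solv) × ℂ²`, and spinors are `Γ`-invariant
functions on Solv. -/
noncomputable def frameSpinStructure (Γ : Subgroup Solv) : SpinStructure (translations Γ) where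
  lift := 1
  lift_clifford := by
    rintro ⟨φ, hφ⟩ p u
    obtain ⟨g, -, rfl⟩ := hφ
    have h : clifford (MulAction.toPermHom Solv Solv g p)
        (fderiv ℝ (MulAction.toPermHom Solv Solv g) p u) = clifford p u := clifford_mul_left g p u
    simpa only [MonoidHom.one_apply, OneMemClass.coe_one, mul_one, one_mul] using h

/-! ### Torus semibundles -/

/-- `σ` is the map `(a v + b w, z) ↦ ((a + 1/2) v - b w, -z)` of Solv, where `v, w` is a basis of
the lattice `Λ = Γ ∩ ℝ²`, and it induces an isometric involution without fixed points of
`Γ \ Solv`. -/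
structure IsSemibundleInvolution (Γ : Subgroup Solv) (v w : ℝ × ℝ) (σ : Equiv.Perm Solv) :
    Prop where
  linearIndependent : LinearIndependent ℝ ![v, w]
  mem_iff : ∀ m : ℝ × ℝ, mk m.1 m.2 0 ∈ Γ ↔ ∃ i j : ℤ, m = (i : ℝ) • v + (j : ℝ) • w
  apply_eq : ∀ a b z : ℝ,
    σ (mk (a * v.1 + b * w.1) (a * v.2 + b * w.2) z)
      = mk ((a + 1 / 2) * v.1 - b * w.1) ((a + 1 / 2) * v.2 - b * w.2) (-z)
  isometry : ∀ p u u' : Solv,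
    metric (σ p) (fderiv ℝ σ p u) (fderiv ℝ σ p u') = metric p u u'
  descends : ∀ g ∈ Γ, ∀ p : Solv, ∃ g' ∈ Γ, σ (g * p) = g' * σ p
  free : ∀ g ∈ Γ, ∀ p : Solv, σ p ≠ g * p

/-- The deck group of the universal cover `Solv → Y`, where `Y` is the quotient of `Γ \ Solv` by the
involution induced by `σ`. -/
noncomputable def semibundleGroup (Γ : Subgroup Solv) (σ : Equiv.Perm Solv) :
    Subgroup (Equiv.Perm Solv) :=
  translations Γ ⊔ Subgroup.zpowers σ

end Solv

/-!
The Levi-Civita terms cancel in the Dirac operator, because Solv is unimodular, so that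
`D ψ = ∑ᵢ σᵢ eᵢ(ψ)` (`Solv.dirac_eq`); in particular constant spinors are harmonic.

Let conversely `ψ` be a harmonic spinor on the universal cover, invariant up to signs under a lattice
`Γ`.  The functions `|eᵢ ψ|` descend to the compact quotient, hence are bounded, which means
`|∂_x ψ| ≤ C e^z` and `|∂_y ψ| ≤ C e^{-z}`.  Moreover `Γ` contains an element `γ` with `z(γ) = t ≠ 0`
and a translation `(a, b, 0)` with `a, b ≠ 0` (`Solv.IsLattice.exists_mk_mem`); the squares of the
conjugates of the latter by powers of `γ` give periods `(e^{-nt} r, e^{nt} s, 0)` of `ψ`.  Two of these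
span the plane, so `ψ` has a Fourier expansion in `(x, y)`.  The mode `(U, V)` of frequency `(ξ, η)`
satisfies
`U' = (ξ e^{-z} - i η e^z) V` and `V' = (ξ e^{-z} + i η e^z) U`.

* If `ξ` and `η` are both nonzero, the bounds on `∂_x ψ` and `∂_y ψ` make the mode decay as `z → -∞`
  and as `z → ∞`.  As `(Re (U V̄))' = ξ e^{-z} (|U|² + |V|²)` has constant sign, the mode vanishes
  (`eq_zero_of_decay`).
* If exactly one of them is nonzero, the frequency takes a nonzero value smaller than `2π` on one of the
  periods, so the mode vanishes (`Solv.mode_eq_zero_of_period`).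

Thus `ψ` depends only on `z`, and the Dirac equation makes it constant
(`Solv.exists_eq_const_of_periodic`, `Solv.IsLattice.exists_eq_const`).

On the quotient `Y` of `Γ \ Solv` by the involution `σ`, the lift of an element of `Γ` to `SU(2)`
commutes with Clifford multiplication, hence is `±1`, so a harmonic spinor is again a constant `c`.
The lift `A` of `σ` anticommutes with `σ₁`, because `σ` reverses `∂_z`; hence `A² = -1`, and
`c = A c = A² c = -c` vanishes.
-/

namespace Solv

/-! ### The Dirac operator in the left-invariant frame -/

@[simp] theorem x_add (p q : Solv) : (p + q).x = p.x + q.x := rfl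
@[simp] theorem y_add (p q : Solv) : (p + q).y = p.y + q.y := rfl
@[simp] theorem z_add (p q : Solv) : (p + q).z = p.z + q.z := rfl
@[simp] theorem x_sub (p q : Solv) : (p - q).x = p.x - q.x := rfl
@[simp] theorem y_sub (p q : Solv) : (p - q).y = p.y - q.y := rfl
@[simp] theorem z_sub (p q : Solv) : (p - q).z = p.z - q.z := rfl
@[simp] theorem x_neg (p : Solv) : (-p).x = -p.x := rfl
@[simp] theorem y_neg (p : Solv) : (-p).y = -p.y := rfl
@[simp] theorem z_neg (p : Solv) : (-p).z = -p.z := rfl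
@[simp] theorem x_smul (a : ℝ) (p : Solv) : (a • p).x = a * p.x := rfl
@[simp] theorem y_smul (a : ℝ) (p : Solv) : (a • p).y = a * p.y := rfl
@[simp] theorem z_smul (a : ℝ) (p : Solv) : (a • p).z = a * p.z := rfl
@[simp] theorem x_zero : (0 : Solv).x = 0 := rfl
@[simp] theorem y_zero : (0 : Solv).y = 0 := rfl
@[simp] theorem z_zero : (0 : Solv).z = 0 := rfl

theorem continuous_x : Continuous Solv.x := continuous_fst (X := ℝ) (Y := ℝ × ℝ)
theorem continuous_y : Continuous Solv.y :=
  continuous_fst.comp (continuous_snd (X := ℝ) (Y := ℝ × ℝ))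
theorem continuous_z : Continuous Solv.z :=
  continuous_snd.comp (continuous_snd (X := ℝ) (Y := ℝ × ℝ))

/-- The coordinate `x` as a continuous linear functional. -/
def xCLM : Solv →L[ℝ] ℝ where
  toFun := Solv.x
  map_add' _ _ := rfl
  map_smul' _ _ := rfl
  cont := continuous_x

/-- The coordinate `y` as a continuous linear functional. -/
def yCLM : Solv →L[ℝ] ℝ where
  toFun := Solv.y
  map_add' _ _ := rfl
  map_smul' _ _ := rfl
  cont := continuous_y

/-- The coordinate `z` as a continuous linear functional. -/
def zCLM : Solv →L[ℝ] ℝ where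
  toFun := Solv.z
  map_add' _ _ := rfl
  map_smul' _ _ := rfl
  cont := continuous_z

@[simp] theorem xCLM_apply (p : Solv) : xCLM p = p.x := rfl
@[simp] theorem yCLM_apply (p : Solv) : yCLM p = p.y := rfl
@[simp] theorem zCLM_apply (p : Solv) : zCLM p = p.z := rfl

theorem frame_one (p : Solv) : frame 1 p = Real.exp (-p.z) • mk 1 0 0 := by
  ext <;> simp [frame]

theorem frame_two (p : Solv) : frame 2 p = Real.exp p.z • mk 0 1 0 := by
  ext <;> simp [frame]

theorem fderiv_frame (i : Fin 3) (p u : Solv) :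
    fderiv ℝ (frame i) p u
      = u.z • ![mk 0 0 0, mk (-Real.exp (-p.z)) 0 0, mk 0 (Real.exp p.z) 0] i := by
  have hz : HasFDerivAt Solv.z zCLM p := zCLM.hasFDerivAt
  fin_cases i
  · have h : frame 0 = fun _ => mk 0 0 1 := rfl
    ext <;> simp [h]
  · have h : HasFDerivAt (frame 1) _ p :=
      ((hz.neg.exp).smul_const (mk 1 0 0)).congr_of_eventuallyEq
        (Filter.Eventually.of_forall frame_one)
    change fderiv ℝ (frame 1) p u = _
    rw [h.fderiv]
    ext <;> simp [mul_comm]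
  · have h : HasFDerivAt (frame 2) _ p :=
      ((hz.exp).smul_const (mk 0 1 0)).congr_of_eventuallyEq
        (Filter.Eventually.of_forall frame_two)
    change fderiv ℝ (frame 2) p u = _
    rw [h.fderiv]
    ext <;> simp [mul_comm]

theorem metric_frame (j k : Fin 3) (p : Solv) :
    metric p (frame j p) (frame k p) = if j = k then 1 else 0 := by
  have h₁ : Real.exp (2 * p.z) * (Real.exp (-p.z) * Real.exp (-p.z)) = 1 := by
    rw [← Real.exp_add, ← Real.exp_add, ← Real.exp_zero]; ring_nf
  have h₂ : Real.exp (-(2 * p.z)) * (Real.exp p.z * Real.exp p.z) = 1 := by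
    rw [← Real.exp_add, ← Real.exp_add, ← Real.exp_zero]; ring_nf
  fin_cases j <;> fin_cases k <;> simp [metric, frame, h₁, h₂]

/-- The structure constants of the left-invariant frame: `[e₁, e₂] = -e₂`, `[e₁, e₃] = e₃` and
`[e₂, e₃] = 0`. -/
theorem lieBracket_frame (i j : Fin 3) :
    VectorField.lieBracket ℝ (frame i) (frame j)
      = fun p => (![![0, -1, 1], ![1, 0, 0], ![-1, 0, 0]] i j : ℝ) • frame (max i j) p := by
  funext p
  rw [VectorField.lieBracket, fderiv_frame, fderiv_frame]
  fin_cases i <;> fin_cases j <;> ext <;> simp [frame]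

theorem metric_smul_left (p u w : Solv) (a : ℝ) : metric p (a • u) w = a * metric p u w := by
  simp [metric]; ring

/-- The only nonzero Christoffel symbols are `Γ₂₁₂ = 1 = -Γ₂₂₁` and `Γ₃₁₃ = -1 = -Γ₃₃₁`. -/
theorem christoffel_eq (i j k : Fin 3) (p : Solv) :
    christoffel i j k p =
      ![![![0, 0, 0], ![0, 0, 0], ![0, 0, 0]], ![![0, 1, 0], ![-1, 0, 0], ![0, 0, 0]],
        ![![0, 0, -1], ![0, 0, 0], ![1, 0, 0]]] i j k := by
  simp only [christoffel, leviCivita, metric_frame, lieBracket_frame, metric_smul_left]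
  fin_cases i <;> fin_cases j <;> fin_cases k <;> norm_num [metric_frame]

theorem clifford_frame (i : Fin 3) (p : Solv) : clifford p (frame i p) = pauli i := by
  simp [clifford, metric_frame]

/-- In the Dirac operator the connection terms `¼ σ_i ∑_{j<k} Γ_{ijk} [σ_j, σ_k]` for `i = 2` and
`i = 3` cancel, because Solv is unimodular. -/
theorem dirac_eq (ψ : Solv → Fin 2 → ℂ) (p : Solv) :
    dirac ψ p = ∑ i, (pauli i).mulVec (fderiv ℝ ψ p (frame i p)) := by
  have h0 : Finset.Ioi (0 : Fin 3) = {1, 2} := by decide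
  have h1 : Finset.Ioi (1 : Fin 3) = {2} := by decide
  have h2 : Finset.Ioi (2 : Fin 3) = ∅ := by decide
  simp only [dirac, clifford_frame, spinConnection, Matrix.mulVec_add, Finset.sum_add_distrib,
    Matrix.mulVec_mulVec]
  rw [add_eq_left, ← Matrix.sum_mulVec]
  refine Eq.trans (congrArg (Matrix.mulVec · (ψ p)) ?_) (Matrix.zero_mulVec _)
  simp only [Fin.sum_univ_three, h0, h1, h2, christoffel_eq]
  simp [pauli]
  ext a b
  fin_cases a <;> fin_cases b <;> simp <;> ring_nf

theorem dirac_apply_zero (ψ : Solv → Fin 2 → ℂ) (p : Solv) :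
    dirac ψ p 0 = Complex.I * fderiv ℝ ψ p (mk 0 0 1) 0
      - fderiv ℝ ψ p (frame 1 p) 1 + Complex.I * fderiv ℝ ψ p (frame 2 p) 1 := by
  rw [dirac_eq]
  simp [Fin.sum_univ_three, pauli, frame]
  ring

theorem dirac_apply_one (ψ : Solv → Fin 2 → ℂ) (p : Solv) :
    dirac ψ p 1 = -(Complex.I * fderiv ℝ ψ p (mk 0 0 1) 1)
      + fderiv ℝ ψ p (frame 1 p) 0 + Complex.I * fderiv ℝ ψ p (frame 2 p) 0 := by
  rw [dirac_eq]
  simp [Fin.sum_univ_three, pauli, frame]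

end Solv

/-! ### Fourier coefficients of periodic functions of one and two variables -/

theorem eq_integral_of_fourier_eq_zero {g : ℝ → ℂ} (hc : Continuous g)
    (hp : Function.Periodic g 1)
    (h : ∀ n : ℤ, n ≠ 0 →
      ∫ x in (0 : ℝ)..1, Complex.exp (-((2 * Real.pi * (n * x) : ℝ) : ℂ) * Complex.I) * g x = 0)
    (x : ℝ) : g x = ∫ y in (0 : ℝ)..1, g y := by
  let f : C(AddCircle (1 : ℝ), ℂ) := ⟨hp.lift, continuous_coinduced_dom.mpr hc⟩
  have hf : ∀ y : ℝ, f y = g y := fun y => hp.lift_coe y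
  have hcoeff : ∀ n : ℤ, fourierCoeff f n =
      ∫ x in (0 : ℝ)..1,
        Complex.exp (-((2 * Real.pi * (n * x) : ℝ) : ℂ) * Complex.I) * g x := by
    intro n
    rw [fourierCoeff_eq_intervalIntegral f n 0]
    simp only [one_div, inv_one, one_smul, zero_add]
    refine intervalIntegral.integral_congr fun y _ => ?_
    simp only [hf, fourier_coe_apply, smul_eq_mul]
    congr 2
    push_cast
    ring
  have hzero : ∀ n : ℤ, n ≠ 0 → fourierCoeff f n = 0 := fun n hn => (hcoeff n).trans (h n hn)
  have hs : Summable (fourierCoeff f) :=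
    summable_of_ne_finset_zero (s := {0}) fun n hn => hzero n (by simpa using hn)
  have h₁ := has_pointwise_sum_fourier_series_of_summable hs (x : AddCircle (1 : ℝ))
  have h₂ := h₁.unique (hasSum_single 0 fun n hn => by rw [hzero n hn, zero_smul])
  rw [hf, hcoeff] at h₂
  simpa using h₂

theorem eq_of_fourier_eq_zero {G : ℝ → ℝ → ℂ} (hc : Continuous (Function.uncurry G))
    (hp₁ : ∀ a b, G (a + 1) b = G a b) (hp₂ : ∀ a b, G a (b + 1) = G a b)
    (h : ∀ m n : ℤ, m ≠ 0 ∨ n ≠ 0 → ∫ a in (0 : ℝ)..1, ∫ b in (0 : ℝ)..1,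
      Complex.exp (-((2 * Real.pi * (m * a + n * b) : ℝ) : ℂ) * Complex.I) * G a b = 0)
    (a b a' b' : ℝ) : G a b = G a' b' := by
  -- The Fourier coefficients of `G a` as functions of `a`.
  let H : ℤ → ℝ → ℂ := fun n a => ∫ b in (0 : ℝ)..1,
      Complex.exp (-((2 * Real.pi * (n * b) : ℝ) : ℂ) * Complex.I) * G a b
  have hHc : ∀ n, Continuous (H n) := fun n => by
    refine intervalIntegral.continuous_parametric_intervalIntegral_of_continuous' ?_ 0 1
    have : Continuous fun p : ℝ × ℝ => G p.1 p.2 := hc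
    change Continuous fun p : ℝ × ℝ =>
      Complex.exp (-((2 * Real.pi * (n * p.2) : ℝ) : ℂ) * Complex.I) * G p.1 p.2
    fun_prop
  have hHp : ∀ n, Function.Periodic (H n) 1 := fun n a => by simp only [H, hp₁]
  have hH : ∀ m n : ℤ, m ≠ 0 ∨ n ≠ 0 → ∫ a in (0 : ℝ)..1,
      Complex.exp (-((2 * Real.pi * (m * a) : ℝ) : ℂ) * Complex.I) * H n a = 0 := by
    intro m n hmn
    rw [← h m n hmn]
    refine intervalIntegral.integral_congr fun a _ => ?_
    simp only [H]
    rw [← intervalIntegral.integral_const_mul]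
    refine intervalIntegral.integral_congr fun b _ => ?_
    rw [← mul_assoc, ← Complex.exp_add]
    congr 2
    push_cast
    ring
  have hHn : ∀ n : ℤ, n ≠ 0 → ∀ a, H n a = 0 := by
    intro n hn a
    rw [eq_integral_of_fourier_eq_zero (hHc n) (hHp n) (fun m _ => hH m n (Or.inr hn)) a]
    simpa using hH 0 n (Or.inr hn)
  have hG : ∀ a b, G a b = H 0 a := by
    intro a b
    have hca : Continuous (G a) := hc.comp (by fun_prop : Continuous fun b : ℝ => (a, b))
    rw [eq_integral_of_fourier_eq_zero hca (hp₂ a) (fun n hn => hHn n hn a) b]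
    simp [H]
  have h0 := eq_integral_of_fourier_eq_zero (hHc 0) (hHp 0) (fun m hm => hH m 0 (Or.inl hm))
  rw [hG, hG, h0 a, h0 a']

/-! ### Differentiation under the integral sign -/

theorem hasDerivAt_integral_of_continuous {F F' : ℝ → ℝ → ℂ}
    (hF : Continuous (Function.uncurry F)) (hF' : Continuous (Function.uncurry F'))
    (hd : ∀ s t, HasDerivAt (fun s => F s t) (F' s t) s) (s : ℝ) :
    HasDerivAt (fun s => ∫ t in (0 : ℝ)..1, F s t) (∫ t in (0 : ℝ)..1, F' s t) s := by
  obtain ⟨C, hC⟩ := ((isCompact_Icc (a := s - 1) (b := s + 1)).prod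
    (isCompact_Icc (a := (0 : ℝ)) (b := 1))).exists_bound_of_continuousOn hF'.continuousOn
  have hFs : ∀ s, Continuous (F s) := fun s =>
    hF.comp (by fun_prop : Continuous fun b : ℝ => (s, b))
  have hFs' : ∀ s, Continuous (F' s) := fun s =>
    hF'.comp (by fun_prop : Continuous fun b : ℝ => (s, b))
  refine (intervalIntegral.hasDerivAt_integral_of_dominated_loc_of_deriv_le
    (bound := fun _ => C) (Icc_mem_nhds (by linarith : s - 1 < s) (by linarith : s < s + 1))
    (Filter.Eventually.of_forall fun s => (hFs s).aestronglyMeasurable)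
    ((hFs s).intervalIntegrable 0 1) (hFs' s).aestronglyMeasurable
    (Filter.Eventually.of_forall fun t ht x hx => ?_) (by simp)
    (Filter.Eventually.of_forall fun t _ x _ => hd x t)).2
  rw [Set.uIoc_of_le zero_le_one] at ht
  exact hC (x, t) ⟨hx, ht.1.le, ht.2⟩

theorem hasDerivAt_integral_integral_of_continuous {F F' : ℝ → ℝ → ℝ → ℂ}
    (hF : Continuous fun p : ℝ × ℝ × ℝ => F p.1 p.2.1 p.2.2)
    (hF' : Continuous fun p : ℝ × ℝ × ℝ => F' p.1 p.2.1 p.2.2)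
    (hd : ∀ s a b, HasDerivAt (fun s => F s a b) (F' s a b) s) (s : ℝ) :
    HasDerivAt (fun s => ∫ a in (0 : ℝ)..1, ∫ b in (0 : ℝ)..1, F s a b)
      (∫ a in (0 : ℝ)..1, ∫ b in (0 : ℝ)..1, F' s a b) s := by
  refine hasDerivAt_integral_of_continuous (F := fun s a => ∫ b in (0 : ℝ)..1, F s a b)
    (F' := fun s a => ∫ b in (0 : ℝ)..1, F' s a b) ?_ ?_ (fun s a => ?_) s
  · refine intervalIntegral.continuous_parametric_intervalIntegral_of_continuous'
      (f := fun (q : ℝ × ℝ) b => F q.1 q.2 b) ?_ 0 1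
    exact hF.comp (by fun_prop : Continuous fun p : (ℝ × ℝ) × ℝ => (p.1.1, p.1.2, p.2))
  · refine intervalIntegral.continuous_parametric_intervalIntegral_of_continuous'
      (f := fun (q : ℝ × ℝ) b => F' q.1 q.2 b) ?_ 0 1
    exact hF'.comp (by fun_prop : Continuous fun p : (ℝ × ℝ) × ℝ => (p.1.1, p.1.2, p.2))
  · exact hasDerivAt_integral_of_continuous (F := fun s b => F s a b)
      (F' := fun s b => F' s a b)
      (hF.comp (by fun_prop : Continuous fun p : ℝ × ℝ => (p.1, a, p.2)))
      (hF'.comp (by fun_prop : Continuous fun p : ℝ × ℝ => (p.1, a, p.2)))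
      (fun s b => hd s a b) s

/-! ### Vanishing of decaying solutions of the reduced equation -/

open Complex ComplexConjugate Filter Topology in
/-- The equation satisfied by a Fourier mode `(U, V)` of a harmonic spinor with frequency
`(ξ, η)`.  Along a solution `Re (U V̄)` has derivative `ξ e^{-z} (|U|² + |V|²)`, which has constant
sign, so a solution that decays at both ends vanishes. -/
theorem eq_zero_of_decay {ξ η C : ℝ} (hξ : ξ ≠ 0) {U V : ℝ → ℂ}
    (hU : ∀ z, HasDerivAt U ((ξ * Real.exp (-z) - I * (η * Real.exp z)) * V z) z)
    (hV : ∀ z, HasDerivAt V ((ξ * Real.exp (-z) + I * (η * Real.exp z)) * U z) z)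
    (hU₁ : ∀ z, ‖U z‖ ≤ C * Real.exp z) (hU₂ : ∀ z, ‖U z‖ ≤ C * Real.exp (-z))
    (hV₁ : ∀ z, ‖V z‖ ≤ C * Real.exp z) (hV₂ : ∀ z, ‖V z‖ ≤ C * Real.exp (-z)) (z : ℝ) :
    U z = 0 ∧ V z = 0 := by
  let g : ℝ → ℝ := fun z => ξ * (U z * conj (V z)).re
  have hg : ∀ z, HasDerivAt g (ξ ^ 2 * Real.exp (-z) * (normSq (U z) + normSq (V z))) z := by
    intro z
    convert! (reCLM.hasFDerivAt.comp_hasDerivAt z ((hU z).mul (hV z).star)).const_mul ξ using 1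
    generalize Real.exp (-z) = A
    generalize Real.exp z = B
    simp [normSq_apply]
    ring
  have hmono : Monotone g := monotone_of_deriv_nonneg (fun z => (hg z).differentiableAt)
    fun z => by
      rw [(hg z).deriv]
      have := normSq_nonneg (U z)
      have := normSq_nonneg (V z)
      positivity
  have hgb : ∀ z, ‖g z‖ ≤ |ξ| * (‖U z‖ * ‖V z‖) := fun z => by
    rw [norm_mul, Real.norm_eq_abs, ← Complex.norm_conj (V z), ← norm_mul]
    exact mul_le_mul_of_nonneg_left (abs_re_le_norm _) (abs_nonneg _)
  have htop : Tendsto g atTop (𝓝 0) := by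
    have h : Tendsto (fun z : ℝ => |ξ| * ((C * Real.exp (-z)) * (C * Real.exp (-z)))) atTop
        (𝓝 (|ξ| * ((C * 0) * (C * 0)))) := by
      have := Real.tendsto_exp_neg_atTop_nhds_zero
      exact ((this.const_mul C).mul (this.const_mul C)).const_mul _
    simp only [mul_zero] at h
    refine squeeze_zero_norm (fun z => (hgb z).trans ?_) h
    have := hU₂ z
    have := hV₂ z
    gcongr
    exact (norm_nonneg _).trans this
  have hbot : Tendsto g atBot (𝓝 0) := by
    have h : Tendsto (fun z : ℝ => |ξ| * ((C * Real.exp z) * (C * Real.exp z))) atBot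
        (𝓝 (|ξ| * ((C * 0) * (C * 0)))) := by
      have := Real.tendsto_exp_atBot
      exact ((this.const_mul C).mul (this.const_mul C)).const_mul _
    simp only [mul_zero] at h
    refine squeeze_zero_norm (fun z => (hgb z).trans ?_) h
    have := hU₁ z
    have := hV₁ z
    gcongr
    exact (norm_nonneg _).trans this
  have hg0 : g = fun _ => 0 := funext fun z =>
    le_antisymm (hmono.ge_of_tendsto htop z) (hmono.le_of_tendsto hbot z)
  have h0 := hg z
  rw [hg0] at h0
  have h1 := h0.unique (hasDerivAt_const z (0 : ℝ))
  have h2 : normSq (U z) + normSq (V z) = 0 := by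
    have : ξ ^ 2 * Real.exp (-z) ≠ 0 := by positivity
    exact (mul_eq_zero.mp h1).resolve_left this
  have := normSq_nonneg (U z)
  have := normSq_nonneg (V z)
  exact ⟨normSq_eq_zero.mp (by linarith), normSq_eq_zero.mp (by linarith)⟩

theorem exists_int_exp_mul_lt {t ε : ℝ} (ht : t ≠ 0) (hε : 0 < ε) :
    ∃ n : ℤ, Real.exp (n * t) < ε := by
  simp only [← Real.lt_log_iff_exp_lt hε]
  rcases lt_or_gt_of_ne ht with h | h
  · obtain ⟨n, hn⟩ := exists_int_gt (Real.log ε / t)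
    exact ⟨n, (div_lt_iff_of_neg h).mp hn⟩
  · obtain ⟨n, hn⟩ := exists_int_lt (Real.log ε / t)
    exact ⟨n, (lt_div_iff₀ h).mp hn⟩

theorem Complex.exp_neg_mul_I_ne_one {c : ℝ} (h0 : c ≠ 0) (h : |c| < 2 * Real.pi) :
    Complex.exp (-(c : ℂ) * Complex.I) ≠ 1 := by
  intro hc
  obtain ⟨n, hn⟩ := Complex.exp_eq_one_iff.mp hc
  have hcn : c = -n * (2 * Real.pi) := by
    have : -(c : ℂ) = n * (2 * Real.pi) :=
      mul_right_cancel₀ Complex.I_ne_zero (by rw [hn]; ring)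
    have h' : -c = n * (2 * Real.pi) := by exact_mod_cast this
    linarith
  have hπ := Real.pi_pos
  rw [hcn, abs_mul, abs_neg, abs_of_pos (by positivity : 0 < 2 * Real.pi)] at h
  have h1 : |(n : ℝ)| < 1 := by nlinarith
  have h2 : n = 0 := by
    rw [← Int.abs_lt_one_iff]; exact_mod_cast h1
  exact h0 (by rw [hcn, h2]; simp)

theorem exists_cramer {a b c d : ℝ} (h : a * d - b * c ≠ 0) (u v : ℝ) :
    ∃ x y : ℝ, x * a + y * b = u ∧ x * c + y * d = v :=
  ⟨(u * d - v * b) / (a * d - b * c), (a * v - c * u) / (a * d - b * c), by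
      rw [div_mul_eq_mul_div, div_mul_eq_mul_div, ← add_div, div_eq_iff h]; ring, by
      rw [div_mul_eq_mul_div, div_mul_eq_mul_div, ← add_div, div_eq_iff h]; ring⟩

namespace Solv

/-! ### Fourier modes along the torus fibres -/

/-- The mean of `φ` over the parallelogram at `p` spanned by `l` and `m`, as an integral in the
coordinates of that parallelogram. -/
noncomputable def cellIntegral (l m : Solv) (φ : Solv → ℂ) (p : Solv) : ℂ :=
  ∫ a in (0 : ℝ)..1, ∫ b in (0 : ℝ)..1, φ (p + a • l + b • m)

/-- The plane wave `q ↦ e^{-i ℓ(q)}`. -/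
noncomputable def planeWave (ℓ : Solv →L[ℝ] ℝ) (q : Solv) : ℂ :=
  Complex.exp (-(ℓ q : ℂ) * Complex.I)

/-- The component of `φ` of frequency `ℓ` in the directions `l` and `m`, multiplied by the plane
wave `e^{-iℓ}`, so that it does not vary in those directions. -/
noncomputable def mode (l m : Solv) (ℓ : Solv →L[ℝ] ℝ) (φ : Solv → ℂ) : Solv → ℂ :=
  cellIntegral l m fun q => planeWave ℓ q * φ q

theorem planeWave_add (ℓ : Solv →L[ℝ] ℝ) (p q : Solv) :
    planeWave ℓ (p + q) = planeWave ℓ p * planeWave ℓ q := by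
  rw [planeWave, planeWave, planeWave, ← Complex.exp_add, map_add]
  congr 1
  push_cast
  ring

theorem norm_planeWave (ℓ : Solv →L[ℝ] ℝ) (p : Solv) : ‖planeWave ℓ p‖ = 1 := by
  rw [planeWave, ← Complex.ofReal_neg, Complex.norm_exp_ofReal_mul_I]

theorem continuous_planeWave (ℓ : Solv →L[ℝ] ℝ) : Continuous (planeWave ℓ) := by
  unfold planeWave; fun_prop

theorem contDiff_planeWave (ℓ : Solv →L[ℝ] ℝ) {n : WithTop ℕ∞} :
    ContDiff ℝ n (planeWave ℓ) :=
  (((Complex.ofRealCLM.comp ℓ).contDiff.neg).mul contDiff_const).cexp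

theorem fderiv_planeWave (ℓ : Solv →L[ℝ] ℝ) (p X : Solv) :
    fderiv ℝ (planeWave ℓ) p X = -(Complex.I * ℓ X * planeWave ℓ p) := by
  have h : HasFDerivAt (planeWave ℓ) _ p :=
    (((Complex.ofRealCLM.comp ℓ).hasFDerivAt (x := p)).neg.mul_const Complex.I).cexp
  rw [h.fderiv]
  simp [planeWave]
  ring

section cell

variable {l m : Solv}

theorem continuous_cell {φ : Solv → ℂ} (hφ : Continuous φ) (p : Solv) :
    Continuous fun q : ℝ × ℝ => φ (p + q.1 • l + q.2 • m) := by
  fun_prop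

theorem norm_cellIntegral_le {φ : Solv → ℂ} {p : Solv} {C : ℝ}
    (h : ∀ a b : ℝ, ‖φ (p + a • l + b • m)‖ ≤ C) : ‖cellIntegral l m φ p‖ ≤ C := by
  have h₁ : ∀ a : ℝ, ‖∫ b in (0 : ℝ)..1, φ (p + a • l + b • m)‖ ≤ C := fun a => by
    simpa using intervalIntegral.norm_integral_le_of_norm_le_const (a := 0) (b := 1)
      fun b _ => h a b
  simpa [cellIntegral] using
    intervalIntegral.norm_integral_le_of_norm_le_const (a := 0) (b := 1) fun a _ => h₁ a

theorem cellIntegral_const_mul (c : ℂ) (φ : Solv → ℂ) (p : Solv) :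
    cellIntegral l m (fun q => c * φ q) p = c * cellIntegral l m φ p := by
  simp only [cellIntegral, intervalIntegral.integral_const_mul]

theorem cellIntegral_add {φ χ : Solv → ℂ} (hφ : Continuous φ) (hχ : Continuous χ) (p : Solv) :
    cellIntegral l m (fun q => φ q + χ q) p = cellIntegral l m φ p + cellIntegral l m χ p := by
  have hb : ∀ {θ : Solv → ℂ}, Continuous θ → ∀ a : ℝ,
      Continuous fun b : ℝ => θ (p + a • l + b • m) := fun h a => by fun_prop
  have ha : ∀ {θ : Solv → ℂ}, Continuous θ →
      Continuous fun a : ℝ => ∫ b in (0 : ℝ)..1, θ (p + a • l + b • m) := fun h =>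
    intervalIntegral.continuous_parametric_intervalIntegral_of_continuous'
      (continuous_cell h p) 0 1
  rw [cellIntegral, cellIntegral, cellIntegral,
    ← intervalIntegral.integral_add ((ha hφ).intervalIntegrable 0 1)
      ((ha hχ).intervalIntegrable 0 1)]
  refine intervalIntegral.integral_congr fun a _ => ?_
  exact intervalIntegral.integral_add ((hb hφ a).intervalIntegrable 0 1)
      ((hb hχ a).intervalIntegrable 0 1)

theorem cellIntegral_eq_zero {φ : Solv → ℂ} {p : Solv}
    (h : ∀ a b : ℝ, φ (p + a • l + b • m) = 0) : cellIntegral l m φ p = 0 := by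
  simp [cellIntegral, h]

theorem cellIntegral_add_cell {φ : Solv → ℂ} (hl : Function.Periodic φ l)
    (hm : Function.Periodic φ m) (p : Solv) (α β : ℝ) :
    cellIntegral l m φ (p + (α • l + β • m)) = cellIntegral l m φ p := by
  have h₁ : ∀ a : ℝ, ∫ b in (0 : ℝ)..1, φ (p + (α • l + β • m) + a • l + b • m)
      = ∫ b in (0 : ℝ)..1, φ (p + (α + a) • l + b • m) := by
    intro a
    have hp : Function.Periodic (fun b : ℝ => φ (p + (α + a) • l + b • m)) 1 := fun b => by
      beta_reduce
      rw [← hm (p + (α + a) • l + b • m)]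
      congr 1
      module
    have := hp.intervalIntegral_add_eq β 0
    rw [zero_add] at this
    have h₃ := intervalIntegral.integral_comp_add_left (a := 0) (b := 1)
      (fun b : ℝ => φ (p + (α + a) • l + b • m)) β
    rw [add_zero] at h₃
    rw [← this, ← h₃]
    refine intervalIntegral.integral_congr fun b _ => ?_
    congr 1
    module
  have h₂ : Function.Periodic (fun a : ℝ => ∫ b in (0 : ℝ)..1, φ (p + a • l + b • m)) 1 := by
    intro a
    refine intervalIntegral.integral_congr fun b _ => ?_
    rw [← hl (p + a • l + b • m)]
    congr 1
    module
  have := h₂.intervalIntegral_add_eq α 0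
  rw [zero_add] at this
  rw [cellIntegral, cellIntegral, ← this]
  simp only [h₁]
  have h₃ := intervalIntegral.integral_comp_add_left (a := 0) (b := 1)
    (fun a : ℝ => ∫ b in (0 : ℝ)..1, φ (p + a • l + b • m)) α
  rw [add_zero] at h₃
  exact h₃

theorem hasDerivAt_cellIntegral {φ : Solv → ℂ} (hφ : ContDiff ℝ 1 φ) (p X : Solv) (s : ℝ) :
    HasDerivAt (fun s : ℝ => cellIntegral l m φ (p + s • X))
      (cellIntegral l m (fun q => fderiv ℝ φ q X) (p + s • X)) s := by
  have hc : Continuous fun q => fderiv ℝ φ q X := (hφ.continuous_fderiv one_ne_zero).clm_apply continuous_const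
  have hc' := hφ.continuous
  refine hasDerivAt_integral_integral_of_continuous
    (F := fun s a b => φ (p + s • X + a • l + b • m))
    (F' := fun s a b => fderiv ℝ φ (p + s • X + a • l + b • m) X) ?_ ?_ (fun s a b => ?_) s
  · fun_prop
  · exact hc.comp (by fun_prop :
      Continuous fun r : ℝ × ℝ × ℝ => p + r.1 • X + r.2.1 • l + r.2.2 • m)
  · have h₁ : HasDerivAt (fun s : ℝ => p + s • X + a • l + b • m) X s := by
      simpa using ((((hasDerivAt_id s).smul_const X).const_add p).add_const (a • l)).add_const
        (b • m)
    exact ((hφ.differentiable one_ne_zero _).hasFDerivAt).comp_hasDerivAt s h₁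

theorem hasDerivAt_mode {ℓ : Solv →L[ℝ] ℝ} {φ : Solv → ℂ} (hφ : ContDiff ℝ 1 φ) (p X : Solv)
    (s : ℝ) :
    HasDerivAt (fun s : ℝ => mode l m ℓ φ (p + s • X))
      (mode l m ℓ (fun q => fderiv ℝ φ q X) (p + s • X)
        - Complex.I * ℓ X * mode l m ℓ φ (p + s • X)) s := by
  have hk := contDiff_planeWave ℓ (n := 1)
  have hc : Continuous fun q => fderiv ℝ φ q X :=
    (hφ.continuous_fderiv one_ne_zero).clm_apply continuous_const
  convert! hasDerivAt_cellIntegral (hk.mul hφ) p X s using 1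
  have h : ∀ q, fderiv ℝ (fun q => planeWave ℓ q * φ q) q X
      = planeWave ℓ q * fderiv ℝ φ q X
        + -(Complex.I * ℓ X) * (planeWave ℓ q * φ q) := by
    intro q
    rw [fderiv_fun_mul (hk.differentiable one_ne_zero q) (hφ.differentiable one_ne_zero q)]
    simp [fderiv_planeWave]
    ring
  change _ = cellIntegral l m (fun q => fderiv ℝ (fun q => planeWave ℓ q * φ q) q X) _
  simp only [h]
  have hk' := hk.continuous
  have hφ' := hφ.continuous
  rw [cellIntegral_add (by fun_prop) (by fun_prop), cellIntegral_const_mul]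
  simp only [mode]
  ring

theorem norm_mode_le {ℓ : Solv →L[ℝ] ℝ} {φ : Solv → ℂ} {p : Solv} {C : ℝ}
    (h : ∀ a b : ℝ, ‖φ (p + a • l + b • m)‖ ≤ C) : ‖mode l m ℓ φ p‖ ≤ C :=
  norm_cellIntegral_le fun a b => by
    simpa [norm_planeWave] using h a b

theorem periodic_planeWave_mul {ℓ : Solv →L[ℝ] ℝ} {φ : Solv → ℂ} {ν : Solv}
    (hφ : Function.Periodic φ ν) {n : ℤ} (h : ℓ ν = 2 * Real.pi * n) :
    Function.Periodic (fun q => planeWave ℓ q * φ q) ν := by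
  intro q
  have h₁ : planeWave ℓ ν = 1 := by
    rw [planeWave, Complex.exp_eq_one_iff]
    refine ⟨-n, ?_⟩
    rw [h]
    push_cast
    ring
  simp only [planeWave_add, h₁, hφ q, mul_one]

/-- A mode does not vary in the directions of the cell. -/
theorem mode_add_cell {ℓ : Solv →L[ℝ] ℝ} {φ : Solv → ℂ} (hl : Function.Periodic φ l)
    (hm : Function.Periodic φ m) {i j : ℤ} (hi : ℓ l = 2 * Real.pi * i)
    (hj : ℓ m = 2 * Real.pi * j) (p : Solv) (α β : ℝ) :
    mode l m ℓ φ (p + (α • l + β • m)) = mode l m ℓ φ p :=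
  cellIntegral_add_cell (periodic_planeWave_mul hl hi) (periodic_planeWave_mul hm hj) p α β

/-- A derivative in a direction of the cell acts on modes as multiplication by `i ℓ`. -/
theorem mode_fderiv {ℓ : Solv →L[ℝ] ℝ} {φ : Solv → ℂ} (hφ : ContDiff ℝ 1 φ)
    (hl : Function.Periodic φ l) (hm : Function.Periodic φ m) {i j : ℤ}
    (hi : ℓ l = 2 * Real.pi * i) (hj : ℓ m = 2 * Real.pi * j) {X : Solv}
    (hX : ∃ α β : ℝ, X = α • l + β • m) (p : Solv) :
    mode l m ℓ (fun q => fderiv ℝ φ q X) p = Complex.I * ℓ X * mode l m ℓ φ p := by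
  have h := hasDerivAt_mode (l := l) (m := m) (ℓ := ℓ) hφ p X 0
  have hconst : (fun s : ℝ => mode l m ℓ φ (p + s • X)) = fun _ => mode l m ℓ φ p := by
    funext s
    obtain ⟨α, β, rfl⟩ := hX
    rw [smul_add, smul_smul, smul_smul, mode_add_cell hl hm hi hj]
  rw [hconst] at h
  have := h.unique (hasDerivAt_const _ _)
  rw [zero_smul, add_zero] at this
  exact sub_eq_zero.mp this

/-- A mode whose frequency is not integral on a further period of the function vanishes. -/
theorem mode_eq_zero_of_period {ℓ : Solv →L[ℝ] ℝ} {φ : Solv → ℂ} (hl : Function.Periodic φ l)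
    (hm : Function.Periodic φ m) {i j : ℤ} (hi : ℓ l = 2 * Real.pi * i)
    (hj : ℓ m = 2 * Real.pi * j) {ν : Solv} (hν : ∃ α β : ℝ, ν = α • l + β • m)
    (hφ : Function.Periodic φ ν) (h : planeWave ℓ ν ≠ 1) (p : Solv) : mode l m ℓ φ p = 0 := by
  have h₁ : mode l m ℓ φ (p + ν) = mode l m ℓ φ p := by
    obtain ⟨α, β, rfl⟩ := hν
    exact mode_add_cell hl hm hi hj p α β
  have h₂ : mode l m ℓ φ (p + ν) = planeWave ℓ ν * mode l m ℓ φ p := by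
    rw [mode, ← cellIntegral_const_mul]
    refine intervalIntegral.integral_congr fun a _ => intervalIntegral.integral_congr fun b _ => ?_
    beta_reduce
    rw [show p + ν + a • l + b • m = (p + a • l + b • m) + ν by abel, hφ, planeWave_add]
    ring
  rw [h₁] at h₂
  have h₃ : (planeWave ℓ ν - 1) * mode l m ℓ φ p = 0 := by linear_combination -h₂
  exact (mul_eq_zero.mp h₃).resolve_left (sub_ne_zero.mpr h)

/-- A doubly periodic function is determined by its modes. -/
theorem eq_of_mode_eq_zero {φ : Solv → ℂ} (hφ : Continuous φ) (hl : Function.Periodic φ l)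
    (hm : Function.Periodic φ m) (p : Solv)
    (h : ∀ i j : ℤ, i ≠ 0 ∨ j ≠ 0 → ∃ ℓ : Solv →L[ℝ] ℝ,
      ℓ l = 2 * Real.pi * i ∧ ℓ m = 2 * Real.pi * j ∧ mode l m ℓ φ p = 0) (α β : ℝ) :
    φ (p + (α • l + β • m)) = φ p := by
  have key := eq_of_fourier_eq_zero (G := fun a b => φ (p + a • l + b • m))
    (continuous_cell hφ p) (fun a b => ?_) (fun a b => ?_) (fun i j hij => ?_) α β 0 0
  · simpa [add_assoc] using key
  · rw [← hl (p + a • l + b • m)]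
    congr 1
    module
  · rw [← hm (p + a • l + b • m)]
    congr 1
    module
  · obtain ⟨ℓ, h₁, h₂, h₃⟩ := h i j hij
    have h₄ : planeWave ℓ p * ∫ a in (0 : ℝ)..1, ∫ b in (0 : ℝ)..1,
        Complex.exp (-((2 * Real.pi * (i * a + j * b) : ℝ) : ℂ) * Complex.I)
          * φ (p + a • l + b • m) = mode l m ℓ φ p := by
      simp only [mode, cellIntegral]
      rw [← intervalIntegral.integral_const_mul]
      refine intervalIntegral.integral_congr fun a _ => ?_
      rw [← intervalIntegral.integral_const_mul]
      refine intervalIntegral.integral_congr fun b _ => ?_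
      rw [add_assoc p, planeWave_add, ← mul_assoc]
      congr 2
      rw [planeWave, map_add, map_smul, map_smul, h₁, h₂]
      simp only [smul_eq_mul]
      congr 4
      ring
    rw [h₃] at h₄
    exact (mul_eq_zero.mp h₄).resolve_left (Complex.exp_ne_zero _)

end cell

/-! ### Harmonic spinors with bounded derivatives and periods spanning the fibres -/

theorem mode_linear_combination {l m : Solv} (hl : l.z = 0) (hm : m.z = 0)
    {ℓ : Solv →L[ℝ] ℝ} {f g h : Solv → ℂ} (hf : Continuous f) (hg : Continuous g)
    (hh : Continuous h) {a b c : ℂ} {p : Solv}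
    (H : ∀ q : Solv, q.z = p.z → a * f q + b * g q + c * h q = 0) :
    a * mode l m ℓ f p + b * mode l m ℓ g p + c * mode l m ℓ h p = 0 := by
  have hk := continuous_planeWave ℓ
  simp only [mode]
  rw [← cellIntegral_const_mul, ← cellIntegral_const_mul, ← cellIntegral_const_mul,
    ← cellIntegral_add (by fun_prop) (by fun_prop),
    ← cellIntegral_add (by fun_prop) (by fun_prop)]
  refine cellIntegral_eq_zero fun α β => ?_
  have := H (p + α • l + β • m) (by simp [hl, hm])
  linear_combination planeWave ℓ (p + α • l + β • m) * this

theorem fderiv_component {ψ : Solv → Fin 2 → ℂ} (hψ : ContDiff ℝ 1 ψ) (i : Fin 2) (p X : Solv) :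
    fderiv ℝ (fun q => ψ q i) p X = fderiv ℝ ψ p X i := by
  have h := hasFDerivAt_pi'.mp (hψ.differentiable one_ne_zero p).hasFDerivAt i
  rw [h.fderiv]
  rfl

theorem hasDerivAt_mode_z {l m : Solv} {ℓ : Solv →L[ℝ] ℝ} (hℓ : ℓ (mk 0 0 1) = 0)
    {φ : Solv → ℂ} (hφ : ContDiff ℝ 1 φ) (z : ℝ) :
    HasDerivAt (fun z => mode l m ℓ φ (mk 0 0 z))
      (mode l m ℓ (fun q => fderiv ℝ φ q (mk 0 0 1)) (mk 0 0 z)) z := by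
  have hs : ∀ s : ℝ, (0 : Solv) + s • mk 0 0 1 = mk 0 0 s := fun s => by ext <;> simp
  simpa [hs, hℓ] using hasDerivAt_mode (l := l) (m := m) (ℓ := ℓ) hφ 0 (mk 0 0 1) z

/-- The equation `D ψ = 0` in coordinates. -/
theorem dirac_eq_zero_iff {ψ : Solv → Fin 2 → ℂ} (hψ : ContDiff ℝ 1 ψ) (p : Solv) :
    dirac ψ p = 0 ↔
      (fderiv ℝ (fun q => ψ q 0) p (mk 0 0 1)
        = -(Complex.I * Real.exp (-p.z)) * fderiv ℝ (fun q => ψ q 1) p (mk 1 0 0)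
          - Real.exp p.z * fderiv ℝ (fun q => ψ q 1) p (mk 0 1 0)) ∧
      (fderiv ℝ (fun q => ψ q 1) p (mk 0 0 1)
        = -(Complex.I * Real.exp (-p.z)) * fderiv ℝ (fun q => ψ q 0) p (mk 1 0 0)
          + Real.exp p.z * fderiv ℝ (fun q => ψ q 0) p (mk 0 1 0)) := by
  have hI : Complex.I * Complex.I = -1 := Complex.I_mul_I
  rw [funext_iff, Fin.forall_fin_two, dirac_apply_zero, dirac_apply_one]
  simp only [fderiv_component hψ, frame_one, frame_two, map_smul, Pi.smul_apply,
    Complex.real_smul, Pi.zero_apply]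
  constructor
  · rintro ⟨h₁, h₂⟩
    constructor
    · linear_combination -Complex.I * h₁ + (fderiv ℝ ψ p (mk 0 0 1) 0
        + Real.exp p.z * fderiv ℝ ψ p (mk 0 1 0) 1) * hI
    · linear_combination Complex.I * h₂ + (fderiv ℝ ψ p (mk 0 0 1) 1
        - Real.exp p.z * fderiv ℝ ψ p (mk 0 1 0) 0) * hI
  · rintro ⟨h₁, h₂⟩
    constructor
    · linear_combination Complex.I * h₁ - (Real.exp (-p.z) * fderiv ℝ ψ p (mk 1 0 0) 1) * hI
    · linear_combination -Complex.I * h₂ + (Real.exp (-p.z) * fderiv ℝ ψ p (mk 1 0 0) 0) * hI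

theorem mode_norm_bound {l m : Solv} {ℓ : Solv →L[ℝ] ℝ} {φ : Solv → ℂ} (hφ : ContDiff ℝ 1 φ)
    (hlφ : Function.Periodic φ l) (hmφ : Function.Periodic φ m) (hl : l.z = 0) (hm : m.z = 0)
    {i j : ℤ} (hi : ℓ l = 2 * Real.pi * i) (hj : ℓ m = 2 * Real.pi * j) {X : Solv}
    (hX : ∃ α β : ℝ, X = α • l + β • m) (hℓX : ℓ X ≠ 0) {B : ℝ} {p : Solv}
    (hB : ∀ q : Solv, q.z = p.z → ‖fderiv ℝ φ q X‖ ≤ B) :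
    ‖mode l m ℓ φ p‖ ≤ B / |ℓ X| := by
  have h₁ : ‖mode l m ℓ (fun q => fderiv ℝ φ q X) p‖ ≤ B :=
    norm_mode_le fun a b => hB _ (by simp [hl, hm])
  rw [mode_fderiv hφ hlφ hmφ hi hj hX, norm_mul, norm_mul, Complex.norm_I, one_mul,
    Complex.norm_real, Real.norm_eq_abs] at h₁
  rw [le_div_iff₀ (abs_pos.mpr hℓX), mul_comm]
  exact h₁

theorem exists_functional (ξ η : ℝ) : ∃ ℓ : Solv →L[ℝ] ℝ, ∀ p, ℓ p = ξ * p.x + η * p.y :=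
  ⟨ξ • xCLM + η • yCLM, fun p => by simp⟩

/-- A harmonic spinor on Solv whose derivatives along `e₂` and `e₃` are bounded, and
which is periodic for all conjugates of a translation of the `(x, y)` plane by the powers of a
hyperbolic element, is constant. -/
theorem exists_eq_const_of_periodic {ψ : Solv → Fin 2 → ℂ} (hψ : ContDiff ℝ 1 ψ)
    (hD : ∀ p, dirac ψ p = 0) {r s t C : ℝ} (hr : r ≠ 0) (hs : s ≠ 0) (ht : t ≠ 0)
    (hper : ∀ n : ℤ,
      Function.Periodic ψ (mk (Real.exp (-(n * t)) * r) (Real.exp (n * t) * s) 0))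
    (hx : ∀ p i, ‖fderiv ℝ ψ p (mk 1 0 0) i‖ ≤ C * Real.exp p.z)
    (hy : ∀ p i, ‖fderiv ℝ ψ p (mk 0 1 0) i‖ ≤ C * Real.exp (-p.z)) :
    ∃ c, ψ = fun _ => c := by
  set ν : ℤ → Solv := fun n => mk (Real.exp (-(n * t)) * r) (Real.exp (n * t) * s) 0 with hν
  have hψi : ∀ i, ContDiff ℝ 1 fun q => ψ q i := fun i => contDiff_pi.mp hψ i
  have hperi : ∀ n i, Function.Periodic (fun q => ψ q i) (ν n) := fun n i q =>
    congrFun (hper n q) i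
  have hcont : ∀ i X, Continuous fun q => fderiv ℝ (fun q => ψ q i) q X := fun i X =>
    ((hψi i).continuous_fderiv one_ne_zero).clm_apply continuous_const
  have hνz : ∀ n, (ν n).z = 0 := fun n => rfl
  have hν0 : ν 0 = mk r s 0 := by simp [hν]
  have hν1 : ν 1 = mk (Real.exp (-t) * r) (Real.exp t * s) 0 := by simp [hν]
  have hdet : r * (Real.exp t * s) - s * (Real.exp (-t) * r) ≠ 0 := by
    have h : r * (Real.exp t * s) - s * (Real.exp (-t) * r)
        = r * s * (Real.exp t - Real.exp (-t)) := by ring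
    rw [h]
    refine mul_ne_zero (mul_ne_zero hr hs) (sub_ne_zero.mpr fun h => ht ?_)
    have := Real.exp_injective h
    linarith
  -- `ν 0` and `ν 1` span the horizontal plane.
  have hspan : ∀ X : Solv, X.z = 0 → ∃ α β : ℝ, X = α • ν 0 + β • ν 1 := by
    intro X hX
    obtain ⟨α, β, h₁, h₂⟩ := exists_cramer
      (a := r) (b := Real.exp (-t) * r) (c := s) (d := Real.exp t * s)
      (by convert hdet using 1; ring) X.x X.y
    refine ⟨α, β, ?_⟩
    rw [hν0, hν1]
    ext
    · simp [← h₁]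
    · simp [← h₂]
    · simp [hX]
  have hC : 0 ≤ C := by
    have := (norm_nonneg _).trans (hx 0 0)
    simpa using this
  -- All modes of nonzero frequency vanish.
  have hmode : ∀ i j : ℤ, i ≠ 0 ∨ j ≠ 0 → ∃ ℓ : Solv →L[ℝ] ℝ,
      ℓ (ν 0) = 2 * Real.pi * i ∧ ℓ (ν 1) = 2 * Real.pi * j ∧
        ∀ k z, mode (ν 0) (ν 1) ℓ (fun q => ψ q k) (mk 0 0 z) = 0 := by
    intro i j hij
    obtain ⟨ξ, η, h₁, h₂⟩ := exists_cramer hdet (2 * Real.pi * i) (2 * Real.pi * j)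
    obtain ⟨ℓ, hℓ⟩ := exists_functional ξ η
    have hi : ℓ (ν 0) = 2 * Real.pi * i := by rw [hℓ, hν0]; exact h₁
    have hj : ℓ (ν 1) = 2 * Real.pi * j := by rw [hℓ, hν1]; exact h₂
    refine ⟨ℓ, hi, hj, ?_⟩
    -- A frequency on a coordinate axis takes a small nonzero value on some period.
    have haxis : ∀ n : ℤ, ℓ (ν n) ≠ 0 → |ℓ (ν n)| < 2 * Real.pi →
        ∀ k z, mode (ν 0) (ν 1) ℓ (fun q => ψ q k) (mk 0 0 z) = 0 := fun n h₀ hlt k z =>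
      mode_eq_zero_of_period (hperi 0 k) (hperi 1 k) hi hj (hspan _ (hνz n)) (hperi n k)
        (Complex.exp_neg_mul_I_ne_one h₀ hlt) _
    have hπ := Real.pi_pos
    by_cases hξ : ξ = 0
    · have hη : η ≠ 0 := by
        rintro rfl
        subst hξ
        have hi' : (i : ℝ) = 0 := by simpa [hπ.ne'] using h₁
        have hj' : (j : ℝ) = 0 := by simpa [hπ.ne'] using h₂
        exact hij.elim (fun h => h (by exact_mod_cast hi')) fun h => h (by exact_mod_cast hj')
      have hpos : 0 < |η * s| := abs_pos.mpr (mul_ne_zero hη hs)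
      obtain ⟨n, hn⟩ := exists_int_exp_mul_lt ht (by positivity : 0 < 2 * Real.pi / |η * s|)
      have hval : ℓ (ν n) = Real.exp (n * t) * (η * s) := by
        rw [hℓ, hξ]; simp only [hν, x_mk, y_mk]; ring
      refine haxis n ?_ ?_
      · rw [hval]
        exact mul_ne_zero (Real.exp_ne_zero _) (mul_ne_zero hη hs)
      · rw [hval, abs_mul, Real.abs_exp]
        exact (lt_div_iff₀ hpos).mp hn
    by_cases hη : η = 0
    · have hpos : 0 < |ξ * r| := abs_pos.mpr (mul_ne_zero hξ hr)
      obtain ⟨n, hn⟩ := exists_int_exp_mul_lt (neg_ne_zero.mpr ht)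
        (by positivity : 0 < 2 * Real.pi / |ξ * r|)
      have hval : ℓ (ν n) = Real.exp (n * -t) * (ξ * r) := by
        rw [hℓ, hη]; simp only [hν, x_mk, y_mk, mul_neg]; ring
      refine haxis n ?_ ?_
      · rw [hval]
        exact mul_ne_zero (Real.exp_ne_zero _) (mul_ne_zero hξ hr)
      · rw [hval, abs_mul, Real.abs_exp]
        exact (lt_div_iff₀ hpos).mp hn
    -- Otherwise the mode decays at both ends.
    have hℓx : ℓ (mk 1 0 0) = ξ := by simp [hℓ]
    have hℓy : ℓ (mk 0 1 0) = η := by simp [hℓ]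
    have hℓz : ℓ (mk 0 0 1) = 0 := by simp [hℓ]
    have hX := hspan (mk 1 0 0) rfl
    have hY := hspan (mk 0 1 0) rfl
    have hb₁ : ∀ k z, ‖mode (ν 0) (ν 1) ℓ (fun q => ψ q k) (mk 0 0 z)‖
        ≤ (C / |ξ| + C / |η|) * Real.exp z := by
      intro k z
      refine (mode_norm_bound (hψi k) (hperi 0 k) (hperi 1 k) (hνz 0) (hνz 1) hi hj hX
        (by rwa [hℓx]) (B := C * Real.exp z) fun q hq => ?_).trans ?_
      · rw [fderiv_component hψ, ← z_mk 0 0 z, ← hq]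
        exact hx q k
      · rw [hℓx, add_mul, mul_div_right_comm]
        have : 0 ≤ C / |η| * Real.exp z := by positivity
        linarith
    have hb₂ : ∀ k z, ‖mode (ν 0) (ν 1) ℓ (fun q => ψ q k) (mk 0 0 z)‖
        ≤ (C / |ξ| + C / |η|) * Real.exp (-z) := by
      intro k z
      refine (mode_norm_bound (hψi k) (hperi 0 k) (hperi 1 k) (hνz 0) (hνz 1) hi hj hY
        (by rwa [hℓy]) (B := C * Real.exp (-z)) fun q hq => ?_).trans ?_
      · rw [fderiv_component hψ, ← z_mk 0 0 z, ← hq]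
        exact hy q k
      · rw [hℓy, add_mul, mul_div_right_comm]
        have : 0 ≤ C / |ξ| * Real.exp (-z) := by positivity
        linarith
    have hU : ∀ z, HasDerivAt (fun z => mode (ν 0) (ν 1) ℓ (fun q => ψ q 0) (mk 0 0 z))
        ((ξ * Real.exp (-z) - Complex.I * (η * Real.exp z))
          * mode (ν 0) (ν 1) ℓ (fun q => ψ q 1) (mk 0 0 z)) z := by
      intro z
      convert! hasDerivAt_mode_z hℓz (hψi 0) z using 1
      have := mode_linear_combination (hνz 0) (hνz 1) (ℓ := ℓ) (hcont 0 (mk 0 0 1))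
        (hcont 1 (mk 1 0 0)) (hcont 1 (mk 0 1 0)) (a := 1)
        (b := Complex.I * Real.exp (-z)) (c := Real.exp z) (p := mk 0 0 z) fun q hq => by
          have h := ((dirac_eq_zero_iff hψ q).mp (hD q)).1
          rw [hq, z_mk] at h
          linear_combination h
      rw [mode_fderiv (hψi 1) (hperi 0 1) (hperi 1 1) hi hj hX,
        mode_fderiv (hψi 1) (hperi 0 1) (hperi 1 1) hi hj hY, hℓx, hℓy] at this
      linear_combination -this + (ξ * Real.exp (-z)
        * mode (ν 0) (ν 1) ℓ (fun q => ψ q 1) (mk 0 0 z)) * Complex.I_mul_I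
    have hV : ∀ z, HasDerivAt (fun z => mode (ν 0) (ν 1) ℓ (fun q => ψ q 1) (mk 0 0 z))
        ((ξ * Real.exp (-z) + Complex.I * (η * Real.exp z))
          * mode (ν 0) (ν 1) ℓ (fun q => ψ q 0) (mk 0 0 z)) z := by
      intro z
      convert! hasDerivAt_mode_z hℓz (hψi 1) z using 1
      have := mode_linear_combination (hνz 0) (hνz 1) (ℓ := ℓ) (hcont 1 (mk 0 0 1))
        (hcont 0 (mk 1 0 0)) (hcont 0 (mk 0 1 0)) (a := 1)
        (b := Complex.I * Real.exp (-z)) (c := -Real.exp z) (p := mk 0 0 z) fun q hq => by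
          have h := ((dirac_eq_zero_iff hψ q).mp (hD q)).2
          rw [hq, z_mk] at h
          linear_combination h
      rw [mode_fderiv (hψi 0) (hperi 0 0) (hperi 1 0) hi hj hX,
        mode_fderiv (hψi 0) (hperi 0 0) (hperi 1 0) hi hj hY, hℓx, hℓy] at this
      linear_combination -this + (ξ * Real.exp (-z)
        * mode (ν 0) (ν 1) ℓ (fun q => ψ q 0) (mk 0 0 z)) * Complex.I_mul_I
    have hUV := eq_zero_of_decay hξ hU hV (hb₁ 0) (hb₂ 0) (hb₁ 1) (hb₂ 1)
    exact Fin.forall_fin_two.mpr ⟨fun z => (hUV z).1, fun z => (hUV z).2⟩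
  -- Hence `ψ` depends on `z` only, and the Dirac equation reduces to `∂_z ψ = 0`.
  have hslice : ∀ p : Solv, ψ p = ψ (mk 0 0 p.z) := by
    intro p
    obtain ⟨α, β, hαβ⟩ := hspan (p - mk 0 0 p.z) (by simp)
    funext k
    have := eq_of_mode_eq_zero (hψi k).continuous (hperi 0 k) (hperi 1 k) (mk 0 0 p.z)
      (fun i j hij => by
        obtain ⟨ℓ, h₁, h₂, h₃⟩ := hmode i j hij
        exact ⟨ℓ, h₁, h₂, h₃ k _⟩) α β
    rw [← hαβ, add_sub_cancel] at this
    exact this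
  have hhor : ∀ p X : Solv, X.z = 0 → fderiv ℝ ψ p X = 0 := by
    intro p X hX
    have h₁ : HasDerivAt (fun a : ℝ => p + a • X) X 0 := by
      simpa using ((hasDerivAt_id (0 : ℝ)).smul_const X).const_add p
    have h₂ : HasFDerivAt ψ (fderiv ℝ ψ p) (p + (0 : ℝ) • X) := by
      simpa using (hψ.differentiable one_ne_zero p).hasFDerivAt
    have h₃ := h₂.comp_hasDerivAt (0 : ℝ) h₁
    have h₄ : (ψ ∘ fun a : ℝ => p + a • X) = fun _ => ψ p := by
      funext a
      rw [Function.comp, hslice, hslice p]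
      simp [hX]
    rw [h₄] at h₃
    exact h₃.unique (hasDerivAt_const _ _)
  have hver : ∀ p : Solv, fderiv ℝ ψ p (mk 0 0 1) = 0 := by
    intro p
    have h := (dirac_eq_zero_iff hψ p).mp (hD p)
    simp only [fderiv_component hψ, hhor p (mk 1 0 0) rfl, hhor p (mk 0 1 0) rfl] at h
    funext k
    fin_cases k
    · simpa using h.1
    · simpa using h.2
  refine ⟨ψ 0, funext fun p => ?_⟩
  refine is_const_of_fderiv_eq_zero (𝕜 := ℝ) (hψ.differentiable one_ne_zero) (fun q => ?_) p 0
  ext1 X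
  have hdec : X = mk X.x X.y 0 + X.z • mk 0 0 1 := by ext <;> simp
  rw [hdec, map_add, map_smul, hhor q _ rfl, hver q]
  simp

/-! ### Lattices in Solv -/

theorem z_mul (p q : Solv) : (p * q).z = p.z + q.z := rfl

theorem z_inv (p : Solv) : p⁻¹.z = -p.z := rfl

theorem z_zpow (p : Solv) (n : ℤ) : (p ^ n).z = n * p.z := by
  let f : Solv →* Multiplicative ℝ :=
    { toFun := fun q => Multiplicative.ofAdd q.z, map_one' := rfl, map_mul' := fun _ _ => rfl }
  have h : f (p ^ n) = f p ^ n := map_zpow f p n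
  have h' : (p ^ n).z = n • p.z := congrArg Multiplicative.toAdd h
  rw [h', zsmul_eq_mul]

theorem conj_mk (g : Solv) (a b : ℝ) :
    g * mk a b 0 * g⁻¹ = mk (Real.exp (-g.z) * a) (Real.exp g.z * b) 0 := by
  have h : Real.exp (-g.z) * Real.exp g.z = 1 := by rw [← Real.exp_add]; simp
  ext
  · simp only [mul_def, inv_def, x_mk, y_mk, z_mk, add_zero]
    linear_combination (-g.x) * h
  · simp only [mul_def, inv_def, x_mk, y_mk, z_mk, add_zero]
    linear_combination (-g.y) * h
  · simp [mul_def, inv_def]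

theorem mk_mul (a b : ℝ) (p : Solv) : mk a b 0 * p = p + mk a b 0 := by
  ext <;> simp [mul_def, add_comm]

namespace IsLattice

variable {Γ : Subgroup Solv}

theorem exists_bound (hΓ : IsLattice Γ) {f : Solv → ℝ} (hf : Continuous f)
    (hinv : ∀ g ∈ Γ, ∀ p, f (g * p) = f p) : ∃ C, ∀ p, f p ≤ C := by
  have := hΓ.cocompact
  let F : Quotient (MulAction.orbitRel Γ Solv) → ℝ := Quotient.lift f (by
    rintro p q ⟨g, rfl⟩
    exact hinv g g.2 q)
  have hF : Continuous F := hf.quotient_lift _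
  obtain ⟨C, hC⟩ := (isCompact_range hF).bddAbove
  exact ⟨C, fun p => hC ⟨Quotient.mk _ p, rfl⟩⟩

theorem exists_z_ne_zero (hΓ : IsLattice Γ) : ∃ g ∈ Γ, g.z ≠ 0 := by
  by_contra! h
  obtain ⟨C, hC⟩ := hΓ.exists_bound continuous_z fun g hg p => by
    rw [z_mul, h g hg, zero_add]
  have := hC (Solv.mk 0 0 (C + 1))
  rw [z_mk] at this
  linarith

/-- If a lattice met the `(x, y)` plane trivially it would be abelian, hence contained in a
conjugate of the `z` axis; but `(x - c) e^z`, for a suitable `c`, is an unbounded function which is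
invariant under such a conjugate. -/
theorem exists_ne_one_z_eq_zero (hΓ : IsLattice Γ) : ∃ g ∈ Γ, g.z = 0 ∧ g ≠ 1 := by
  by_contra! h
  obtain ⟨γ, hγ, hz⟩ := hΓ.exists_z_ne_zero
  have hcomm : ∀ g ∈ Γ, g * γ = γ * g := by
    intro g hg
    have h₁ := h (g * γ * g⁻¹ * γ⁻¹)
      (Γ.mul_mem (Γ.mul_mem (Γ.mul_mem hg hγ) (Γ.inv_mem hg)) (Γ.inv_mem hγ))
      (by simp only [z_mul, z_inv]; ring)
    rw [mul_inv_eq_one, mul_inv_eq_iff_eq_mul] at h₁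
    exact h₁
  have hne : 1 - Real.exp (-γ.z) ≠ 0 := by
    rw [sub_ne_zero]
    intro h'
    exact hz (by simpa using (Real.exp_eq_one_iff _).mp h'.symm)
  -- `c` is the first coordinate of the fixed point of the action of `γ` on the plane.
  obtain ⟨c, hc⟩ : ∃ c, c * (1 - Real.exp (-γ.z)) = γ.x := ⟨_, div_mul_cancel₀ _ hne⟩
  have hx : ∀ g ∈ Γ, g.x = c * (1 - Real.exp (-g.z)) := by
    intro g hg
    have h₁ : g.x + Real.exp (-g.z) * γ.x = γ.x + Real.exp (-γ.z) * g.x :=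
      congrArg Solv.x (hcomm g hg)
    refine mul_right_cancel₀ hne ?_
    linear_combination h₁ - (1 - Real.exp (-g.z)) * hc
  have hcx := continuous_x
  have hcz := continuous_z
  obtain ⟨C, hC⟩ := hΓ.exists_bound (f := fun p => (p.x - c) * Real.exp p.z) (by fun_prop)
    fun g hg p => by
      have h₁ : (g * p).x = g.x + Real.exp (-g.z) * p.x := rfl
      have h₂ : Real.exp (-g.z) * Real.exp g.z = 1 := by rw [← Real.exp_add]; simp
      rw [h₁, z_mul, hx g hg, Real.exp_add]
      linear_combination (p.x - c) * Real.exp p.z * h₂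
  have := hC (Solv.mk (c + C + 1) 0 0)
  simp only [x_mk, z_mk, Real.exp_zero] at this
  linarith

theorem exists_norm_lt (hΓ : IsLattice Γ) : ∃ ε > 0, ∀ g ∈ Γ, ‖g‖ < ε → g = 1 := by
  have := hΓ.discrete
  obtain ⟨U, hU, hU₁⟩ := isOpen_induced_iff.mp (isOpen_discrete ({1} : Set Γ))
  have h1 : (0 : Solv) ∈ U := by
    have : (1 : Γ) ∈ (Subtype.val ⁻¹' U : Set Γ) := hU₁ ▸ Set.mem_singleton _
    exact this
  obtain ⟨ε, hε, hball⟩ := Metric.isOpen_iff.mp hU 0 h1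
  refine ⟨ε, hε, fun g hg hgε => ?_⟩
  have : (⟨g, hg⟩ : Γ) ∈ (Subtype.val ⁻¹' U : Set Γ) := hball (mem_ball_zero_iff.mpr hgε)
  rw [hU₁] at this
  exact congrArg Subtype.val this

theorem mk_conj_mem {γ : Solv} (hγ : γ ∈ Γ) {a b : ℝ} (h : Solv.mk a b 0 ∈ Γ) (n : ℤ) :
    Solv.mk (Real.exp (-(n * γ.z)) * a) (Real.exp (n * γ.z) * b) 0 ∈ Γ := by
  rw [← z_zpow, ← conj_mk]
  exact Γ.mul_mem (Γ.mul_mem (Γ.zpow_mem hγ n) h) (Γ.inv_mem (Γ.zpow_mem hγ n))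

/-- A lattice contains a translation of the `(x, y)` plane along neither axis: the conjugates of a
translation along an axis by the powers of a hyperbolic element would accumulate at `1`. -/
theorem exists_mk_mem (hΓ : IsLattice Γ) : ∃ a b : ℝ, a ≠ 0 ∧ b ≠ 0 ∧ Solv.mk a b 0 ∈ Γ := by
  obtain ⟨γ, hγ, hz⟩ := hΓ.exists_z_ne_zero
  obtain ⟨g, hg, hgz, hg1⟩ := hΓ.exists_ne_one_z_eq_zero
  obtain ⟨ε, hε, hΓε⟩ := hΓ.exists_norm_lt
  have hgm : g = Solv.mk g.x g.y 0 := by ext <;> simp [hgz]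
  rw [hgm] at hg
  have hnorm₁ : ∀ a : ℝ, ‖Solv.mk a 0 0‖ = |a| := fun a => by
    change max ‖a‖ (max ‖(0 : ℝ)‖ ‖(0 : ℝ)‖) = |a|
    simp
  have hnorm₂ : ∀ a : ℝ, ‖Solv.mk 0 a 0‖ = |a| := fun a => by
    change max ‖(0 : ℝ)‖ (max ‖a‖ ‖(0 : ℝ)‖) = |a|
    simp
  refine ⟨g.x, g.y, fun hx => ?_, fun hy => ?_, hg⟩
  · have hy : g.y ≠ 0 := fun hy => hg1 (by rw [hgm, hx, hy]; rfl)
    obtain ⟨n, hn⟩ := exists_int_exp_mul_lt hz (div_pos hε (abs_pos.mpr hy))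
    have h := mk_conj_mem hγ hg n
    rw [hx, mul_zero] at h
    have h₁ := hΓε _ h (by
      rw [hnorm₂, abs_mul, Real.abs_exp]; exact (lt_div_iff₀ (abs_pos.mpr hy)).mp hn)
    exact mul_ne_zero (Real.exp_ne_zero _) hy (congrArg Solv.y h₁)
  · have hx : g.x ≠ 0 := fun hx => hg1 (by rw [hgm, hx, hy]; rfl)
    obtain ⟨n, hn⟩ := exists_int_exp_mul_lt (neg_ne_zero.mpr hz) (div_pos hε (abs_pos.mpr hx))
    have h := mk_conj_mem hγ hg n
    rw [hy, mul_zero, ← mul_neg] at h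
    have h₁ := hΓε _ h (by
      rw [hnorm₁, abs_mul, Real.abs_exp]; exact (lt_div_iff₀ (abs_pos.mpr hx)).mp hn)
    exact mul_ne_zero (Real.exp_ne_zero _) hx (congrArg Solv.x h₁)

end IsLattice

/-! ### Harmonic spinors on quotients of Solv by lattices -/

theorem differentiable_mul_left (g : Solv) : Differentiable ℝ fun q : Solv => g * q := by
  have h : (fun q : Solv => g * q) = fun q => g + (Real.exp (-g.z) * xCLM q) • mk 1 0 0
      + (Real.exp g.z * yCLM q) • mk 0 1 0 + zCLM q • mk 0 0 1 := by
    funext q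
    ext <;> simp [mul_def]
  rw [h]
  fun_prop

theorem fderiv_mul_left_frame (g p : Solv) (i : Fin 3) :
    fderiv ℝ (fun q : Solv => g * q) p (frame i p) = frame i (g * p) := by
  rw [fderiv_mul_left]
  fin_cases i <;> ext <;> simp [frame, mul_def, Real.exp_add, mul_comm]

/-- A harmonic spinor on the universal cover that is invariant up to signs under a lattice is
constant. -/
theorem IsLattice.exists_eq_const {Γ : Subgroup Solv} (hΓ : IsLattice Γ)
    {ψ : Solv → Fin 2 → ℂ} (hψ : ContDiff ℝ 1 ψ) (hD : ∀ p, dirac ψ p = 0)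
    (hinv : ∀ g ∈ Γ, ∃ ε : ℝ, ε ^ 2 = 1 ∧ ∀ p, ψ (g * p) = ε • ψ p) :
    ∃ c, ψ = fun _ => c := by
  have hd := hψ.differentiable one_ne_zero
  -- The derivatives along the frame have invariant norms, so they are bounded.
  have hbound : ∀ i, Continuous (frame i) →
      ∃ C, ∀ p, ‖fderiv ℝ ψ p (frame i p)‖ ≤ C := by
    intro i hi
    refine hΓ.exists_bound (((hψ.continuous_fderiv one_ne_zero).clm_apply hi).norm)
      fun g hg p => ?_
    obtain ⟨ε, hε, hg⟩ := hinv g hg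
    have h₁ : fderiv ℝ (fun q => ψ (g * q)) p (frame i p)
        = fderiv ℝ ψ (g * p) (frame i (g * p)) := by
      rw [← fderiv_mul_left_frame]
      exact congrArg (fun L : Solv →L[ℝ] Fin 2 → ℂ => L (frame i p))
        (fderiv_comp p (hd (g * p)) (differentiable_mul_left g p))
    rw [← h₁, funext hg, fderiv_fun_const_smul (hd p)]
    have hε' : |ε| = 1 := by
      rcases sq_eq_one_iff.mp hε with rfl | rfl <;> simp
    rw [smul_apply, norm_smul, Real.norm_eq_abs, hε', one_mul]
  have hcz := continuous_z
  obtain ⟨C₁, hC₁⟩ := hbound 1 (by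
    rw [funext frame_one]; fun_prop)
  obtain ⟨C₂, hC₂⟩ := hbound 2 (by
    rw [funext frame_two]; fun_prop)
  obtain ⟨γ, hγ, hz⟩ := hΓ.exists_z_ne_zero
  obtain ⟨a, b, ha, hb, hab⟩ := hΓ.exists_mk_mem
  -- Squares of elements of the lattice preserve `ψ` without sign, hence the factors `2`.
  refine exists_eq_const_of_periodic hψ hD (r := 2 * a) (s := 2 * b) (t := γ.z)
    (C := max C₁ C₂) (mul_ne_zero two_ne_zero ha) (mul_ne_zero two_ne_zero hb) hz
    (fun n p => ?_) (fun p i => ?_) (fun p i => ?_)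
  · obtain ⟨ε, hε, h⟩ := hinv _ (IsLattice.mk_conj_mem hγ hab n)
    have h₁ : p + Solv.mk (Real.exp (-(n * γ.z)) * (2 * a)) (Real.exp (n * γ.z) * (2 * b)) 0
        = Solv.mk (Real.exp (-(n * γ.z)) * a) (Real.exp (n * γ.z) * b) 0
          * (Solv.mk (Real.exp (-(n * γ.z)) * a) (Real.exp (n * γ.z) * b) 0 * p) := by
      rw [mk_mul, mk_mul]
      ext
      · simp only [x_add, x_mk]; ring
      · simp only [y_add, y_mk]; ring
      · simp
    rw [h₁, h, h, smul_smul, ← pow_two, hε, one_smul]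
  · have h₁ : Solv.mk 1 0 0 = Real.exp p.z • frame 1 p := by
      rw [frame_one, smul_smul, ← Real.exp_add]; simp
    rw [h₁, map_smul]
    refine (norm_le_pi_norm _ i).trans ?_
    rw [norm_smul, Real.norm_eq_abs, Real.abs_exp, mul_comm]
    gcongr
    exact (hC₁ p).trans (le_max_left _ _)
  · have h₁ : Solv.mk 0 1 0 = Real.exp (-p.z) • frame 2 p := by
      rw [frame_two, smul_smul, ← Real.exp_add]; simp
    rw [h₁, map_smul]
    refine (norm_le_pi_norm _ i).trans ?_
    rw [norm_smul, Real.norm_eq_abs, Real.abs_exp, mul_comm]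
    gcongr
    exact (hC₂ p).trans (le_max_right _ _)

theorem dirac_const (c : Fin 2 → ℂ) (p : Solv) : dirac (fun _ => c) p = 0 := by
  simp [dirac_eq]

/-! ### Lifts to the spin group -/

/-- Elements of `SU(2)` that commute with Clifford multiplication are `±1`. -/
theorem eq_smul_one_of_commute_pauli {A : Matrix.specialUnitaryGroup (Fin 2) ℂ}
    (h : ∀ i, pauli i * A.1 = A.1 * pauli i) :
    ∃ ε : ℝ, ε ^ 2 = 1 ∧ A.1 = (ε : ℂ) • (1 : Matrix (Fin 2) (Fin 2) ℂ) := by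
  have hdet : A.1.det = 1 := (Matrix.mem_specialUnitaryGroup_iff.mp A.2).2
  generalize A.1 = B at h hdet
  have h01 : B 0 1 = 0 := by
    have := congrFun (congrFun (h 0) 0) 1
    simp [pauli, Matrix.mul_apply] at this
    have h2 : (2 * Complex.I) * B 0 1 = 0 := by linear_combination this
    simpa using h2
  have h10 : B 1 0 = 0 := by
    have := congrFun (congrFun (h 0) 1) 0
    simp [pauli, Matrix.mul_apply] at this
    have h2 : (2 * Complex.I) * B 1 0 = 0 := by linear_combination -this
    simpa using h2
  have h11 : B 1 1 = B 0 0 := by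
    have := congrFun (congrFun (h 1) 1) 0
    simpa [pauli, Matrix.mul_apply] using this.symm
  rw [Matrix.det_fin_two, h01, h11, zero_mul, sub_zero, ← pow_two] at hdet
  have hB : B = B 0 0 • (1 : Matrix (Fin 2) (Fin 2) ℂ) := by
    ext i j
    fin_cases i <;> fin_cases j <;> simp [h01, h10, h11]
  rcases sq_eq_one_iff.mp hdet with h' | h'
  · exact ⟨1, by norm_num, by rw [hB, h']; simp⟩
  · exact ⟨-1, by norm_num, by rw [hB, h']; simp⟩

/-- An element of `SU(2)` that covers a rotation reversing `e₁` covers a half turn, so it squares to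
`-1`. -/
theorem mul_self_eq_neg_one_of_anticommute {A : Matrix.specialUnitaryGroup (Fin 2) ℂ}
    (h : -pauli 0 * A.1 = A.1 * pauli 0) : A.1 * A.1 = -1 := by
  have hdet : A.1.det = 1 := (Matrix.mem_specialUnitaryGroup_iff.mp A.2).2
  generalize A.1 = B at h hdet
  have h00 : B 0 0 = 0 := by
    have := congrFun (congrFun h 0) 0
    simp [pauli, Matrix.mul_apply] at this
    have h2 : (2 * Complex.I) * B 0 0 = 0 := by linear_combination -this
    simpa using h2
  have h11 : B 1 1 = 0 := by
    have := congrFun (congrFun h 1) 1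
    simp [pauli, Matrix.mul_apply] at this
    have h2 : (2 * Complex.I) * B 1 1 = 0 := by linear_combination this
    simpa using h2
  rw [Matrix.det_fin_two, h00, h11] at hdet
  ext i j
  fin_cases i <;> fin_cases j <;> simp [Matrix.mul_apply, h00, h11]
  · linear_combination -hdet
  · linear_combination -hdet

theorem clifford_neg (p u : Solv) : clifford p (-u) = -clifford p u := by
  have h : ∀ w, metric p (-u) w = -metric p u w := fun w => by simp [metric]; ring
  simp [clifford, h]

/-- The involution reverses the `z` axis. -/
theorem IsSemibundleInvolution.fderiv_z {Γ : Subgroup Solv} {v w : ℝ × ℝ}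
    {σ : Equiv.Perm Solv} (hσ : IsSemibundleInvolution Γ v w σ) :
    fderiv ℝ σ 0 (Solv.mk 0 0 1) = -Solv.mk 0 0 1 := by
  have hd : DifferentiableAt ℝ σ 0 := by
    by_contra hd
    have := hσ.isometry 0 (Solv.mk 0 0 1) (Solv.mk 0 0 1)
    rw [fderiv_zero_of_not_differentiableAt hd] at this
    simp [metric] at this
  have h₁ : HasDerivAt (fun a : ℝ => a • Solv.mk 0 0 1) (Solv.mk 0 0 1) 0 := by
    simpa using (hasDerivAt_id (0 : ℝ)).smul_const (Solv.mk 0 0 1)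
  have hd' : HasFDerivAt σ (fderiv ℝ σ 0) ((0 : ℝ) • Solv.mk 0 0 1) := by
    simpa using hd.hasFDerivAt
  have h₂ := hd'.comp_hasDerivAt (0 : ℝ) h₁
  have h₃ : (σ ∘ fun a : ℝ => a • Solv.mk 0 0 1)
      = fun a : ℝ => Solv.mk (1 / 2 * v.1) (1 / 2 * v.2) 0 + a • -Solv.mk 0 0 1 := by
    funext a
    have h := hσ.apply_eq 0 0 a
    have h' : a • Solv.mk 0 0 1 = Solv.mk (0 * v.1 + 0 * w.1) (0 * v.2 + 0 * w.2) a := by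
      ext <;> simp
    rw [Function.comp, h', h]
    ext <;> simp
  rw [h₃] at h₂
  have h₄ : HasDerivAt (fun a : ℝ => Solv.mk (1 / 2 * v.1) (1 / 2 * v.2) 0 + a • -Solv.mk 0 0 1)
      (-Solv.mk 0 0 1) 0 := by
    simpa using ((hasDerivAt_id (0 : ℝ)).smul_const (-Solv.mk 0 0 1)).const_add
      (Solv.mk (1 / 2 * v.1) (1 / 2 * v.2) 0)
  exact h₂.unique h₄

end Solv

theorem mainTheorem4 (Γ : Subgroup Solv) (hΓ : Solv.IsLattice Γ) :
    Solv.kerDirac (Solv.frameSpinStructure Γ)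
        = {ψ : Solv → Fin 2 → ℂ | ∃ c : Fin 2 → ℂ, ψ = fun _ => c} ∧
    ∀ (v w : ℝ × ℝ) (σ : Equiv.Perm Solv), Solv.IsSemibundleInvolution Γ v w σ →
      ∀ s : Solv.SpinStructure (Solv.semibundleGroup Γ σ), Solv.kerDirac s = {0} := by
  have h1 : (1 : WithTop ℕ∞) ≤ ∞ := by exact_mod_cast le_top
  refine ⟨Set.Subset.antisymm ?_ ?_, fun v w σ hσ s => Set.Subset.antisymm ?_ ?_⟩
  · rintro ψ ⟨⟨hψ, hinv⟩, hD⟩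
    refine hΓ.exists_eq_const (hψ.of_le h1) hD fun g hg => ⟨1, one_pow 2, fun p => ?_⟩
    have := hinv ⟨MulAction.toPermHom Solv Solv g, Subgroup.mem_map_of_mem _ hg⟩ p
    simpa [Solv.frameSpinStructure] using this
  · rintro ψ ⟨c, rfl⟩
    exact ⟨⟨contDiff_const, fun φ p => by simp [Solv.frameSpinStructure]⟩, Solv.dirac_const c⟩
  · rintro ψ ⟨⟨hψ, hinv⟩, hD⟩
    obtain ⟨c, rfl⟩ := hΓ.exists_eq_const (hψ.of_le h1) hD fun g hg => by
      let φ : Solv.semibundleGroup Γ σ := ⟨MulAction.toPermHom Solv Solv g,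
        Subgroup.mem_sup_left (Subgroup.mem_map_of_mem _ hg)⟩
      obtain ⟨ε, hε, h⟩ := Solv.eq_smul_one_of_commute_pauli (A := s.lift φ) fun i => by
        have h₁ := s.lift_clifford φ 1 (Solv.frame i 1)
        have h₂ : Solv.clifford (φ.1 1) (fderiv ℝ φ.1 1 (Solv.frame i 1))
            = Solv.clifford 1 (Solv.frame i 1) := Solv.clifford_mul_left g 1 _
        rwa [h₂, Solv.clifford_frame] at h₁
      refine ⟨ε, hε, fun p => ?_⟩
      have h₁ : ψ (g * p) = (s.lift φ).1.mulVec (ψ p) := hinv φ p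
      rw [h₁, h, Matrix.smul_mulVec, Matrix.one_mulVec]
      rfl
    let φ : Solv.semibundleGroup Γ σ :=
      ⟨σ, Subgroup.mem_sup_right (Subgroup.mem_zpowers σ)⟩
    have h₁ := s.lift_clifford φ 0 (Solv.mk 0 0 1)
    have h₂ : Solv.clifford (φ.1 0) (fderiv ℝ φ.1 0 (Solv.mk 0 0 1)) = -Solv.pauli 0 := by
      change Solv.clifford (σ 0) (fderiv ℝ σ 0 (Solv.mk 0 0 1)) = _
      rw [hσ.fderiv_z, Solv.clifford_neg]
      exact congrArg Neg.neg (Solv.clifford_frame 0 (σ 0))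
    have h₃ : Solv.clifford 0 (Solv.mk 0 0 1) = Solv.pauli 0 := Solv.clifford_frame 0 0
    rw [h₂, h₃] at h₁
    have hA := Solv.mul_self_eq_neg_one_of_anticommute h₁
    have hc : c = (s.lift φ).1.mulVec c := hinv φ 0
    have hcc : c = -c := by
      calc c = (s.lift φ).1.mulVec ((s.lift φ).1.mulVec c) := by rw [← hc, ← hc]
        _ = -c := by rw [Matrix.mulVec_mulVec, hA, Matrix.neg_mulVec, Matrix.one_mulVec]
    have hc0 : c = 0 := self_eq_neg.mp hcc
    rw [hc0]
    rfl
  · rintro ψ rfl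
    exact ⟨⟨contDiff_const, fun φ p => by simp⟩, Solv.dirac_const 0⟩
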